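/- **Lemma (average-case double-sided zero-search).** Let $n\ge 0$, $K\ge 1$ and $T\ge 0$ be integers. A *zero pair* of a permutation $\varphi:\{0,1\}^{2n}\to\{0,1\}^{2n}$ is a pair $(x,y)$ of strings $x,y\in\{0,1\}^n$ with $\varphi(x\|0^n)=y\|0^n$. Let $\varphi$ be drawn uniformly at random from all permutations of $\{0,1\}^{2n}$ that have exactly $K$ zero pairs. Let $\mathcal A$ be a quantum algorithm, with an arbitrary finite number of qubits, consisting of unitary gates, measurements (whose outcomes may determine the later operations) and, along every sequence of measurement outcomes, at most $T$ queries in total to the oracle gates $O^{\varphi}$ and $O^{\varphi^{-1}}$, where $O^f|u\rangle|v\rangle=|u\rangle|v\oplus f(u)\rangle$. At the end $\mathcal A$ outputs a pair of $n$-bit strings. Let $\epsilon$ be the probability, over the choice of $\varphi$ and the measurements of $\mathcal A$, that the output of $\mathcal A^{\varphi,\varphi^{-1}}$ is a zero pair of $\varphi$. Then $$\epsilon\le\frac{8(T+1)^2K}{2^n}.$$ -/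

import Mathlib

namespace ZeroSearch

/-- Bit strings of length `k`. -/
abbrev Bits (k : ℕ) : Type := Fin k → Bool

/-- Bitwise addition modulo 2. -/
def bxor {k : ℕ} (a b : Bits k) : Bits k := fun i => a i ^^ b i

theorem bxor_bxor {k : ℕ} (a b : Bits k) : bxor (bxor a b) b = a := by
  funext i
  simp [bxor]

/-- The string `x ‖ 0ⁿ` of length `2n = n + n`. -/
def padZero {n : ℕ} (x : Bits n) : Bits (n + n) := Fin.append x (fun _ => false)

/-- Permutations of the set of `2n`-bit strings. -/
abbrev BitPerm (n : ℕ) : Type := Equiv.Perm (Bits (n + n))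

/-- The zero pairs of `φ`: the pairs `(x, y)` with `φ (x ‖ 0ⁿ) = y ‖ 0ⁿ`. -/
def zeroPairs {n : ℕ} (φ : BitPerm n) : Finset (Bits n × Bits n) :=
  Finset.univ.filter fun p => φ (padZero p.1) = padZero p.2

/-- The `2n`-bit permutations that have exactly `K` zero pairs. -/
def permsWithZeroPairs (n K : ℕ) : Finset (BitPerm n) :=
  Finset.univ.filter fun φ => (zeroPairs φ).card = K

/-- Computational basis labels: a `2n`-bit query input register, a `2n`-bit query answer
register, and `m` qubits of workspace. -/
abbrev Label (n m : ℕ) : Type := Bits (n + n) × Bits (n + n) × Bits m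

/-- The Hilbert space of `2n + 2n + m` qubits. -/
abbrev StateSpace (n m : ℕ) : Type := EuclideanSpace ℂ (Label n m)

/-- The basis permutation `(x, y, w) ↦ (x, y ⊕ f x, w)`. -/
def queryPerm {n : ℕ} (m : ℕ) (f : Bits (n + n) → Bits (n + n)) : Equiv.Perm (Label n m) where
  toFun b := (b.1, bxor b.2.1 (f b.1), b.2.2)
  invFun b := (b.1, bxor b.2.1 (f b.1), b.2.2)
  left_inv b := by simp [bxor_bxor]
  right_inv b := by simp [bxor_bxor]

/-- The unitary oracle gate `O^f : |x⟩|y⟩|w⟩ ↦ |x⟩|y ⊕ f x⟩|w⟩`. -/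
noncomputable def oracleGate {n : ℕ} (m : ℕ) (f : Bits (n + n) → Bits (n + n)) :
    StateSpace n m ≃ₗᵢ[ℂ] StateSpace n m :=
  LinearIsometryEquiv.piLpCongrLeft 2 ℂ ℂ (queryPerm m f)

/-- Quantum query algorithms with access to a `2n`-bit permutation and its inverse, using `m`
qubits of workspace. An algorithm performs a sequence of unitary gates, measurements (with
operators `M i` satisfying the completeness relation, the later operations being allowed to depend
on the outcome `i`) and queries in the forward or in the backward direction, and finally outputs
a pair of `n`-bit strings. -/
inductive QueryAlg (n m : ℕ) : Type where
  /-- Stop and output the pair `(x, y)`. -/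
  | output (x y : Bits n) : QueryAlg n m
  /-- Apply a unitary that does not depend on the oracle. -/
  | gate (U : StateSpace n m ≃ₗᵢ[ℂ] StateSpace n m) (next : QueryAlg n m) : QueryAlg n m
  /-- Perform a measurement and continue according to its outcome. -/
  | measure {r : ℕ} (M : Fin r → (StateSpace n m →L[ℂ] StateSpace n m))
      (complete : ∑ i, (ContinuousLinearMap.adjoint (M i)).comp (M i) =
        ContinuousLinearMap.id ℂ (StateSpace n m))
      (next : Fin r → QueryAlg n m) : QueryAlg n m
  /-- Query the permutation. -/
  | queryForward (next : QueryAlg n m) : QueryAlg n m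
  /-- Query the inverse of the permutation. -/
  | queryInverse (next : QueryAlg n m) : QueryAlg n m

namespace QueryAlg

/-- The number of queries, in both directions together, that the algorithm makes for the worst
sequence of measurement outcomes. -/
def queryCount {n m : ℕ} : QueryAlg n m → ℕ
  | output _ _ => 0
  | gate _ next => next.queryCount
  | measure _ _ next => Finset.univ.sup fun i => (next i).queryCount
  | queryForward next => next.queryCount + 1
  | queryInverse next => next.queryCount + 1

/-- The probability of the output `p` when the algorithm runs with the permutation `φ` from the
state `ψ`. States after a measurement are left unnormalized, so that the squared norm of `ψ` is
the probability of the measurement outcomes seen so far. -/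
noncomputable def outputProb {n m : ℕ} (φ : BitPerm n) (p : Bits n × Bits n) :
    QueryAlg n m → StateSpace n m → ℝ
  | output x y, ψ => if (x, y) = p then ‖ψ‖ ^ 2 else 0
  | gate U next, ψ => next.outputProb φ p (U ψ)
  | measure M _ next, ψ => ∑ i, (next i).outputProb φ p (M i ψ)
  | queryForward next, ψ => next.outputProb φ p (oracleGate m φ ψ)
  | queryInverse next, ψ => next.outputProb φ p (oracleGate m φ.symm ψ)

end QueryAlg

/-- The initial state, with all qubits in the state `|0⟩`. -/
noncomputable def initialState (n m : ℕ) : StateSpace n m :=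
  EuclideanSpace.single ((fun _ => false), (fun _ => false), (fun _ => false)) 1

/-- The probability that the algorithm outputs a zero pair of `φ` when it runs with `φ`. -/
noncomputable def successProb {n m : ℕ} (A : QueryAlg n m) (φ : BitPerm n) : ℝ :=
  ∑ p ∈ zeroPairs φ, A.outputProb φ p (initialState n m)

/-- The probability that the algorithm outputs a zero pair of `φ`, over a uniformly random `2n`-bit
permutation `φ` with exactly `K` zero pairs and over the measurements of the algorithm. -/
noncomputable def averageSuccessProb {n m : ℕ} (A : QueryAlg n m) (K : ℕ) : ℝ :=
  (∑ φ ∈ permsWithZeroPairs n K, successProb A φ) / ((permsWithZeroPairs n K).card : ℝ)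

end ZeroSearch

namespace ZeroSearch

/-! ### Query algorithms and the hybrid argument -/

/-! Let `Z` be the set of padded strings and `N = 2 ^ n` its size. A uniform `φ` with `K` zero pairs
can be sampled by planting them: take `χ` without zero pairs, a bijection `γ` from `Z` onto the
`χ`-preimage of `Z`, and a `K`-subset `B` of `Z`; then compose `χ` with the exchange of each `u ∈ B`
and `γ u`. The result is uniform because pre- and postcomposition with permutations preserving `Z`
act transitively on the permutations of given overlap (`exists_conj_of_overlap_eq`) and lift to the
data (`card_fibre_swapped_le`), so all fibres of `swapped` have the same size.

Fix `χ` and `γ`. The planted permutation and its inverse differ from those of `χ` only at points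
tied to `B`, and each point is affected for at most `(N - 1).choose (K - 1)` of the `N.choose K`
subsets, a fraction `K / N`. The hybrid argument (`probIn_le_hybrid`) compares with the run on `χ`,
which is independent of `B`: its chance of hitting a planted pair and its mean query weight on
changed points are both governed by this fraction (`sum_probIn_le`, `sum_disturbance_le`). -/

theorem norm_sub_sq_le_two_mul {E : Type*} [SeminormedAddCommGroup E] (a b : E) :
    ‖a - b‖ ^ 2 ≤ 2 * ‖a‖ ^ 2 + 2 * ‖b‖ ^ 2 := by
  have h := norm_sub_le a b
  nlinarith [sq_nonneg (‖a‖ - ‖b‖), norm_nonneg (a - b), norm_nonneg a, norm_nonneg b]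

/-- Two oracle gates differ on a state by at most the weight of the queries on which the two
functions differ. -/
theorem norm_oracleGate_sub_sq_le {n m : ℕ} (f g : Bits (n + n) → Bits (n + n))
    (ψ : StateSpace n m) :
    ‖oracleGate m f ψ - oracleGate m g ψ‖ ^ 2 ≤
      4 * ∑ b : Label n m, if f b.1 ≠ g b.1 then ‖ψ b‖ ^ 2 else 0 := by
  -- A query leaves its input register alone, so reindexing by `queryPerm` preserves the condition
  -- on `b.1`.
  have key : ∀ h : Bits (n + n) → Bits (n + n),
      ∑ b : Label n m, (if f b.1 ≠ g b.1 then ‖ψ (queryPerm m h b)‖ ^ 2 else 0) =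
        ∑ b : Label n m, if f b.1 ≠ g b.1 then ‖ψ b‖ ^ 2 else 0 := fun h =>
    Equiv.sum_comp (queryPerm m h) fun b : Label n m => if f b.1 ≠ g b.1 then ‖ψ b‖ ^ 2 else 0
  calc ‖oracleGate m f ψ - oracleGate m g ψ‖ ^ 2
      = ∑ b, ‖ψ (queryPerm m f b) - ψ (queryPerm m g b)‖ ^ 2 := by
        rw [EuclideanSpace.norm_sq_eq]; rfl
    _ ≤ ∑ b : Label n m, (2 * (if f b.1 ≠ g b.1 then ‖ψ (queryPerm m f b)‖ ^ 2 else 0) +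
          2 * (if f b.1 ≠ g b.1 then ‖ψ (queryPerm m g b)‖ ^ 2 else 0)) := by
        refine Finset.sum_le_sum fun b _ => ?_
        split_ifs with h
        · exact norm_sub_sq_le_two_mul _ _
        · have : queryPerm m f b = queryPerm m g b := by
            simp only [ne_eq, not_not] at h
            simp [queryPerm, h]
          simp [this]
    _ = _ := by
        rw [Finset.sum_add_distrib, ← Finset.mul_sum, ← Finset.mul_sum, key f, key g]; ring

theorem sum_norm_sq_measure {n m r : ℕ} (M : Fin r → (StateSpace n m →L[ℂ] StateSpace n m))
    (complete : ∑ i, (ContinuousLinearMap.adjoint (M i)).comp (M i) =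
      ContinuousLinearMap.id ℂ (StateSpace n m)) (ψ : StateSpace n m) :
    ∑ i, ‖M i ψ‖ ^ 2 = ‖ψ‖ ^ 2 := by
  have h := congrArg (fun L => RCLike.re (inner ℂ (L ψ) ψ)) complete
  simp only [_root_.sum_apply, sum_inner, map_sum,
    ContinuousLinearMap.apply_norm_sq_eq_inner_adjoint_left] at h ⊢
  rw [h, ContinuousLinearMap.id_apply, inner_self_eq_norm_sq]

namespace QueryAlg

/-- The probability that the output lies in `S`. -/
noncomputable def probIn {n m : ℕ} (φ : BitPerm n) (S : Finset (Bits n × Bits n))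
    (A : QueryAlg n m) (ψ : StateSpace n m) : ℝ :=
  ∑ p ∈ S, A.outputProb φ p ψ

section probIn

variable {n m : ℕ} (φ : BitPerm n) (S : Finset (Bits n × Bits n)) (ψ : StateSpace n m)

theorem probIn_output (x y : Bits n) :
    (output x y : QueryAlg n m).probIn φ S ψ = if (x, y) ∈ S then ‖ψ‖ ^ 2 else 0 := by
  simp [probIn, outputProb]

theorem probIn_gate (U : StateSpace n m ≃ₗᵢ[ℂ] StateSpace n m) (next : QueryAlg n m) :
    (gate U next).probIn φ S ψ = next.probIn φ S (U ψ) := rfl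

theorem probIn_measure {r : ℕ} (M : Fin r → (StateSpace n m →L[ℂ] StateSpace n m))
    (complete : ∑ i, (ContinuousLinearMap.adjoint (M i)).comp (M i) =
      ContinuousLinearMap.id ℂ (StateSpace n m)) (next : Fin r → QueryAlg n m) :
    (measure M complete next).probIn φ S ψ = ∑ i, (next i).probIn φ S (M i ψ) := by
  simp only [probIn, outputProb]
  exact Finset.sum_comm

theorem probIn_queryForward (next : QueryAlg n m) :
    (queryForward next).probIn φ S ψ = next.probIn φ S (oracleGate m φ ψ) := rfl

theorem probIn_queryInverse (next : QueryAlg n m) :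
    (queryInverse next).probIn φ S ψ = next.probIn φ S (oracleGate m φ.symm ψ) := rfl

end probIn

theorem probIn_le_norm_sq {n m : ℕ} (φ : BitPerm n) (S : Finset (Bits n × Bits n))
    (A : QueryAlg n m) (ψ : StateSpace n m) : A.probIn φ S ψ ≤ ‖ψ‖ ^ 2 := by
  induction A generalizing ψ with
  | output x y =>
    rw [probIn_output]
    split_ifs
    · exact le_rfl
    · positivity
  | gate U next ih => simpa [probIn_gate] using ih (U ψ)
  | measure M complete next ih =>
    rw [probIn_measure, ← sum_norm_sq_measure M complete ψ]
    exact Finset.sum_le_sum fun i _ => ih i _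
  | queryForward next ih => simpa [probIn_queryForward] using ih (oracleGate m φ ψ)
  | queryInverse next ih => simpa [probIn_queryInverse] using ih (oracleGate m φ.symm ψ)

/-- The sum, over all queries of a run with `χ`, of the squared distance by which the state after
the query would change if this query were answered with `φ`. -/
noncomputable def disturbance {n m : ℕ} (φ χ : BitPerm n) : QueryAlg n m → StateSpace n m → ℝ
  | output _ _, _ => 0
  | gate U next, ψ => next.disturbance φ χ (U ψ)
  | measure M _ next, ψ => ∑ i, (next i).disturbance φ χ (M i ψ)
  | queryForward next, ψ =>
    ‖oracleGate m φ ψ - oracleGate m χ ψ‖ ^ 2 + next.disturbance φ χ (oracleGate m χ ψ)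
  | queryInverse next, ψ =>
    ‖oracleGate m φ.symm ψ - oracleGate m χ.symm ψ‖ ^ 2 +
      next.disturbance φ χ (oracleGate m χ.symm ψ)

/-- Cauchy–Schwarz with weights `c` and `1`. Dividing squared distances by a growing weight keeps
the error quadratic, hence additive over measurement branches, while the total loses only a factor
linear in the number of queries. -/
theorem norm_add_sq_div_le {E : Type*} [SeminormedAddCommGroup E] (a b : E) {c : ℝ} (hc : 0 < c) :
    ‖a + b‖ ^ 2 / (c + 1) ≤ ‖a‖ ^ 2 / c + ‖b‖ ^ 2 := by
  have h : ‖a + b‖ ^ 2 ≤ (‖a‖ + ‖b‖) ^ 2 := by gcongr; exact norm_add_le a b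
  have h1 : (‖a‖ ^ 2 / c + ‖b‖ ^ 2) * (c + 1) =
      (‖a‖ + ‖b‖) ^ 2 + (‖a‖ - c * ‖b‖) ^ 2 / c := by
    field_simp
    ring
  have h2 : 0 ≤ (‖a‖ - c * ‖b‖) ^ 2 / c := by positivity
  rw [div_le_iff₀ (by positivity), h1]
  linarith

/-- Split `U ψ - V ψ'` as `U (ψ - ψ') + (U ψ' - V ψ')`. A query moves one unit from the remaining
budget to the weight, so the prefactor stays constant. -/
theorem hybrid_query_step {n m : ℕ} (U V : StateSpace n m ≃ₗᵢ[ℂ] StateSpace n m)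
    (ψ ψ' : StateSpace n m) {c : ℝ} (hc : 0 < c) {t w P Q : ℝ} (ht : 0 ≤ t)
    (h : P ≤ 2 * Q + 2 * (c + 1 + t) * (‖U ψ - V ψ'‖ ^ 2 / (c + 1) + w)) :
    P ≤ 2 * Q + 2 * (c + (t + 1)) * (‖ψ - ψ'‖ ^ 2 / c + (‖U ψ' - V ψ'‖ ^ 2 + w)) := by
  have h1 := norm_add_sq_div_le (U (ψ - ψ')) (U ψ' - V ψ') hc
  rw [map_sub, sub_add_sub_cancel, ← map_sub, U.norm_map] at h1
  have h2 : 2 * (c + 1 + t) * (‖U ψ - V ψ'‖ ^ 2 / (c + 1) + w) ≤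
      2 * (c + 1 + t) * (‖ψ - ψ'‖ ^ 2 / c + ‖U ψ' - V ψ'‖ ^ 2 + w) := by gcongr
  linarith

/-- Hybrid argument: comparison of a run with `φ` from `ψ` and a run with `χ` from `ψ'`. -/
theorem probIn_le_hybrid {n m : ℕ} (φ χ : BitPerm n) (S : Finset (Bits n × Bits n))
    (A : QueryAlg n m) {T : ℕ} (hA : A.queryCount ≤ T) {c : ℝ} (hc : 0 < c)
    (ψ ψ' : StateSpace n m) :
    A.probIn φ S ψ ≤ 2 * A.probIn χ S ψ' +
      2 * (c + T) * (‖ψ - ψ'‖ ^ 2 / c + A.disturbance φ χ ψ') := by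
  induction A generalizing ψ ψ' c T with
  | output x y =>
    simp only [probIn_output, disturbance, add_zero]
    have h1 : ‖ψ‖ ^ 2 ≤ 2 * ‖ψ'‖ ^ 2 + 2 * ‖ψ - ψ'‖ ^ 2 := by
      have := norm_sub_sq_le_two_mul ψ' (ψ' - ψ)
      rwa [sub_sub_cancel, norm_sub_rev ψ' ψ] at this
    have h2 : 2 * ‖ψ - ψ'‖ ^ 2 ≤ 2 * (c + T) * (‖ψ - ψ'‖ ^ 2 / c) := by
      have h3 : 0 ≤ (T : ℝ) * (‖ψ - ψ'‖ ^ 2 / c) := by positivity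
      have h4 : c * (‖ψ - ψ'‖ ^ 2 / c) = ‖ψ - ψ'‖ ^ 2 := by field_simp
      linarith
    split_ifs
    · linarith
    · have := sq_nonneg ‖ψ - ψ'‖
      linarith
  | gate U next ih =>
    have := ih hA hc (U ψ) (U ψ')
    rwa [← map_sub, U.norm_map] at this
  | measure M complete next ih =>
    -- Every term is a sum over outcomes, by completeness for the squared distance, so the branches
    -- can be compared one by one.
    rw [probIn_measure, probIn_measure, ← sum_norm_sq_measure M complete (ψ - ψ')]
    simp only [disturbance, Finset.mul_sum, Finset.sum_div, ← Finset.sum_add_distrib]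
    refine Finset.sum_le_sum fun i _ => ?_
    rw [map_sub]
    exact ih i ((Finset.le_sup (f := fun i => (next i).queryCount) (Finset.mem_univ i)).trans hA)
      hc _ _
  | queryForward next ih =>
    obtain ⟨t, rfl⟩ : ∃ t, T = t + 1 := ⟨T - 1, by simp only [queryCount] at hA; omega⟩
    have := ih (T := t) (by simpa [queryCount] using hA) (c := c + 1) (by positivity)
      (oracleGate m φ ψ) (oracleGate m χ ψ')
    push_cast
    exact hybrid_query_step _ _ _ _ hc (Nat.cast_nonneg t) this
  | queryInverse next ih =>
    obtain ⟨t, rfl⟩ : ∃ t, T = t + 1 := ⟨T - 1, by simp only [queryCount] at hA; omega⟩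
    have := ih (T := t) (by simpa [queryCount] using hA) (c := c + 1) (by positivity)
      (oracleGate m φ.symm ψ) (oracleGate m χ.symm ψ')
    push_cast
    exact hybrid_query_step _ _ _ _ hc (Nat.cast_nonneg t) this

/-! ### Averaging the hybrid bound over a family of permutations -/

section family

variable {ι : Type*} {n m : ℕ} (s : Finset ι) (c : ℝ)

theorem sum_norm_oracleGate_sub_sq_le (f : ι → Bits (n + n) → Bits (n + n))
    (g : Bits (n + n) → Bits (n + n))
    (hf : ∀ u, ((s.filter fun a => f a u ≠ g u).card : ℝ) ≤ c) (ψ : StateSpace n m) :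
    ∑ a ∈ s, ‖oracleGate m (f a) ψ - oracleGate m g ψ‖ ^ 2 ≤ 4 * c * ‖ψ‖ ^ 2 := by
  calc _ ≤ ∑ a ∈ s, 4 * ∑ b : Label n m, (if f a b.1 ≠ g b.1 then ‖ψ b‖ ^ 2 else 0) :=
        Finset.sum_le_sum fun a _ => norm_oracleGate_sub_sq_le _ _ _
    _ = 4 * ∑ b : Label n m, ((s.filter fun a => f a b.1 ≠ g b.1).card : ℝ) * ‖ψ b‖ ^ 2 := by
        rw [← Finset.mul_sum, Finset.sum_comm]
        simp only [← Finset.sum_filter, Finset.sum_const, nsmul_eq_mul]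
    _ ≤ 4 * ∑ b : Label n m, c * ‖ψ b‖ ^ 2 := by
        gcongr with b
        exact hf b.1
    _ = 4 * c * ‖ψ‖ ^ 2 := by rw [EuclideanSpace.norm_sq_eq, ← Finset.mul_sum]; ring

/-- If every point is changed by few members of a family of permutations, then the members of the
family disturb an algorithm little on average. -/
theorem sum_disturbance_le (hc : 0 ≤ c) (φ : ι → BitPerm n) (χ : BitPerm n)
    (hf : ∀ u, ((s.filter fun a => φ a u ≠ χ u).card : ℝ) ≤ c)
    (hb : ∀ u, ((s.filter fun a => (φ a).symm u ≠ χ.symm u).card : ℝ) ≤ c)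
    (A : QueryAlg n m) {T : ℕ} (hA : A.queryCount ≤ T) (ψ : StateSpace n m) :
    ∑ a ∈ s, A.disturbance (φ a) χ ψ ≤ 4 * c * T * ‖ψ‖ ^ 2 := by
  induction A generalizing ψ T with
  | output x y => simp only [disturbance, Finset.sum_const_zero]; positivity
  | gate U next ih => simpa [disturbance] using ih hA (U ψ)
  | measure M complete next ih =>
    simp only [disturbance]
    rw [Finset.sum_comm, ← sum_norm_sq_measure M complete ψ, Finset.mul_sum]
    exact Finset.sum_le_sum fun i _ =>
      ih i ((Finset.le_sup (f := fun i => (next i).queryCount) (Finset.mem_univ i)).trans hA) _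
  | queryForward next ih =>
    obtain ⟨t, rfl⟩ : ∃ t, T = t + 1 := ⟨T - 1, by simp only [queryCount] at hA; omega⟩
    have h1 := ih (T := t) (by simpa [queryCount] using hA) (oracleGate m χ ψ)
    have h2 := sum_norm_oracleGate_sub_sq_le s c (fun a => φ a) χ hf ψ
    rw [LinearIsometryEquiv.norm_map] at h1
    simp only [disturbance, Finset.sum_add_distrib]
    push_cast
    linarith
  | queryInverse next ih =>
    obtain ⟨t, rfl⟩ : ∃ t, T = t + 1 := ⟨T - 1, by simp only [queryCount] at hA; omega⟩
    have h1 := ih (T := t) (by simpa [queryCount] using hA) (oracleGate m χ.symm ψ)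
    have h2 := sum_norm_oracleGate_sub_sq_le s c (fun a => (φ a).symm) χ.symm hb ψ
    rw [LinearIsometryEquiv.norm_map] at h1
    simp only [disturbance, Finset.sum_add_distrib]
    push_cast
    linarith

/-- The run depends on `χ` alone, so each of its outputs is counted once for every member `a` whose
target set contains it. -/
theorem sum_probIn_le (χ : BitPerm n) (S : ι → Finset (Bits n × Bits n))
    (hS : ∀ p, ((s.filter fun a => p ∈ S a).card : ℝ) ≤ c)
    (A : QueryAlg n m) (ψ : StateSpace n m) :
    ∑ a ∈ s, A.probIn χ (S a) ψ ≤ c * ‖ψ‖ ^ 2 := by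
  induction A generalizing ψ with
  | output x y =>
    simp only [probIn_output, ← Finset.sum_filter, Finset.sum_const, nsmul_eq_mul]
    gcongr
    exact hS _
  | gate U next ih => simpa [probIn_gate] using ih (U ψ)
  | measure M complete next ih =>
    simp only [probIn_measure]
    rw [Finset.sum_comm, ← sum_norm_sq_measure M complete ψ, Finset.mul_sum]
    exact Finset.sum_le_sum fun i _ => ih i _
  | queryForward next ih => simpa [probIn_queryForward] using ih (oracleGate m χ ψ)
  | queryInverse next ih => simpa [probIn_queryInverse] using ih (oracleGate m χ.symm ψ)

end family

end QueryAlg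

theorem norm_initialState (n m : ℕ) : ‖initialState n m‖ = 1 := by
  simp [initialState]

theorem successProb_eq_probIn {n m : ℕ} (A : QueryAlg n m) (φ : BitPerm n) :
    successProb A φ = A.probIn φ (zeroPairs φ) (initialState n m) := rfl

theorem successProb_le_one {n m : ℕ} (A : QueryAlg n m) (φ : BitPerm n) :
    successProb A φ ≤ 1 := by
  simpa [norm_initialState, successProb_eq_probIn] using A.probIn_le_norm_sq φ (zeroPairs φ) (initialState n m)

/-- Finding zero pairs is hard on average for a family of permutations that are all close to a
permutation `χ`, when every point and every zero pair belong to few members of the family. -/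
theorem sum_successProb_le {ι : Type*} {n m : ℕ} (s : Finset ι) {c : ℝ} (hc : 0 ≤ c)
    (φ : ι → BitPerm n) (χ : BitPerm n)
    (hf : ∀ u, ((s.filter fun a => φ a u ≠ χ u).card : ℝ) ≤ c)
    (hb : ∀ u, ((s.filter fun a => (φ a).symm u ≠ χ.symm u).card : ℝ) ≤ c)
    (hz : ∀ p, ((s.filter fun a => p ∈ zeroPairs (φ a)).card : ℝ) ≤ c)
    (A : QueryAlg n m) {T : ℕ} (hA : A.queryCount ≤ T) :
    ∑ a ∈ s, successProb A (φ a) ≤ 8 * ((T : ℝ) + 1) ^ 2 * c := by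
  have h1 := QueryAlg.sum_disturbance_le s c hc φ χ hf hb A hA (initialState n m)
  have h2 := QueryAlg.sum_probIn_le s c χ (fun a => zeroPairs (φ a)) hz A (initialState n m)
  rw [norm_initialState, one_pow, mul_one] at h1 h2
  calc ∑ a ∈ s, successProb A (φ a)
      ≤ ∑ a ∈ s, (2 * A.probIn χ (zeroPairs (φ a)) (initialState n m) +
          2 * (1 + T) * A.disturbance (φ a) χ (initialState n m)) := by
        refine Finset.sum_le_sum fun a _ => ?_
        -- Both runs start in the same state, so the distance term vanishes and the initial weight
        -- can be 1.
        simpa [successProb_eq_probIn] using A.probIn_le_hybrid (φ a) χ (zeroPairs (φ a)) hA one_pos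
          (initialState n m) (initialState n m)
    _ ≤ 2 * c + 2 * (1 + T) * (4 * c * T) := by
        rw [Finset.sum_add_distrib, ← Finset.mul_sum, ← Finset.mul_sum]
        gcongr
    _ ≤ 8 * ((T : ℝ) + 1) ^ 2 * c := by
        have : 0 ≤ c * T := by positivity
        linarith

/-! ### Swapping points of a subset with points outside -/

/-- Two maps with fibres of the same cardinalities differ by a permutation. -/
theorem exists_perm_comp_eq {D C : Type*} [Fintype D] [DecidableEq C] (f g : D → C)
    (h : ∀ c, (Finset.univ.filter fun u => f u = c).card =
      (Finset.univ.filter fun u => g u = c).card) :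
    ∃ τ : Equiv.Perm D, ∀ u, g (τ u) = f u := by
  have e : ∀ c, Nonempty ({u // f u = c} ≃ {u // g u = c}) := fun c =>
    Fintype.card_eq.1 (by rw [Fintype.card_subtype, Fintype.card_subtype, h c])
  replace e := fun c => (e c).some
  refine ⟨(Equiv.sigmaFiberEquiv f).symm.trans
    ((Equiv.sigmaCongrRight e).trans (Equiv.sigmaFiberEquiv g)), fun u => ?_⟩
  exact (e (f u) ⟨u, rfl⟩).2

section swapOn

variable {D : Type*} [DecidableEq D]

/-- The map that exchanges every `u ∈ A` with `γ u`. -/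
def swapOn (A : Finset D) (γ : Equiv.Perm D) (u : D) : D :=
  if u ∈ A then γ u else if γ.symm u ∈ A then γ.symm u else u

theorem swapOn_involutive {A : Finset D} {γ : Equiv.Perm D} (h : ∀ u ∈ A, γ u ∉ A) :
    Function.Involutive (swapOn A γ) := by
  intro u
  unfold swapOn
  by_cases h1 : u ∈ A
  · simp [h1, h u h1]
  · by_cases h2 : γ.symm u ∈ A <;> simp [h1, h2]

open Classical in
/-- The permutation that exchanges every `u ∈ A` with `γ u`, when no `γ u` belongs to `A`. -/
noncomputable def swapPerm (A : Finset D) (γ : Equiv.Perm D) : Equiv.Perm D :=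
  if h : ∀ u ∈ A, γ u ∉ A then (swapOn_involutive h).toPerm else 1

theorem swapPerm_apply {A : Finset D} {γ : Equiv.Perm D} (h : ∀ u ∈ A, γ u ∉ A) (u : D) :
    swapPerm A γ u = swapOn A γ u := by
  rw [swapPerm, dif_pos h]; rfl

theorem swapPerm_symm_apply {A : Finset D} {γ : Equiv.Perm D} (h : ∀ u ∈ A, γ u ∉ A) (u : D) :
    (swapPerm A γ).symm u = swapOn A γ u := by
  rw [swapPerm, dif_pos h]; rfl

theorem mem_or_mem_of_swapOn_ne {A : Finset D} {γ : Equiv.Perm D} {u : D}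
    (h : swapOn A γ u ≠ u) : u ∈ A ∨ γ.symm u ∈ A := by
  by_contra! h'
  simp [swapOn, h'.1, h'.2] at h

theorem swapOn_map (A : Finset D) (γ τ : Equiv.Perm D) (u : D) :
    swapOn (A.map τ.toEmbedding) (τ * γ * τ⁻¹) (τ u) = τ (swapOn A γ u) := by
  have : (τ * γ * τ⁻¹).symm (τ u) = τ (γ.symm u) := by
    rw [Equiv.symm_apply_eq]; simp
  have h : (τ * γ * τ⁻¹) (τ u) = τ (γ u) := by simp
  simp only [swapOn, this, h, Finset.mem_map_equiv, Equiv.symm_apply_apply]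
  split_ifs <;> rfl

theorem card_filter_mem_powersetCard {Z : Finset D} {u : D} (hu : u ∈ Z) (k : ℕ) :
    ((Z.powersetCard (k + 1)).filter fun A => u ∈ A).card = (Z.card - 1).choose k := by
  rw [← Finset.card_erase_of_mem hu, ← Finset.card_powersetCard]
  refine Finset.card_nbij' (fun A => A.erase u) (fun A => insert u A) ?_ ?_ ?_ ?_
  · intro A hA
    simp only [Finset.coe_filter, Finset.mem_powersetCard, Set.mem_ofPred_eq, Finset.mem_coe] at hA ⊢
    exact ⟨Finset.erase_subset_erase u hA.1.1, by rw [Finset.card_erase_of_mem hA.2, hA.1.2]; rfl⟩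
  · intro A hA
    simp only [Finset.coe_filter, Finset.mem_powersetCard, Set.mem_ofPred_eq, Finset.mem_coe] at hA ⊢
    refine ⟨⟨Finset.insert_subset hu (hA.1.trans (Finset.erase_subset u Z)), ?_⟩,
      Finset.mem_insert_self u A⟩
    rw [Finset.card_insert_of_notMem fun h => Finset.notMem_erase u Z (hA.1 h), hA.2]
  · intro A hA
    exact Finset.insert_erase (Finset.mem_filter.1 hA).2
  · intro A hA
    exact Finset.erase_insert fun h =>
      Finset.notMem_erase u Z ((Finset.mem_powersetCard.1 hA).1 h)

/-- At most `(|Z| - 1).choose k` subsets contain `u` or its preimage `γ.symm u`. -/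
theorem card_filter_mem_or_mem_le {Z : Finset D} {γ : Equiv.Perm D} (hγ : ∀ u ∈ Z, γ u ∉ Z)
    (k : ℕ) (u : D) :
    ((Z.powersetCard (k + 1)).filter fun A => u ∈ A ∨ γ.symm u ∈ A).card ≤
      (Z.card - 1).choose k := by
  -- Since `γ` maps `Z` off itself, `u` and `γ.symm u` are not both in `Z`; only one of them can lie
  -- in a subset of `Z`.
  have key : ∃ v, ∀ A ⊆ Z, (u ∈ A ∨ γ.symm u ∈ A) → v ∈ A := by
    by_cases h : u ∈ Z
    · refine ⟨u, fun A hA => ?_⟩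
      rintro (h1 | h1)
      · exact h1
      · exact absurd h (by simpa using hγ _ (hA h1))
    · exact ⟨γ.symm u, fun A hA h1 => h1.resolve_left fun h2 => h (hA h2)⟩
  obtain ⟨v, hv⟩ := key
  by_cases hZ : v ∈ Z
  · rw [← card_filter_mem_powersetCard hZ k]
    refine Finset.card_le_card fun A hA => ?_
    simp only [Finset.mem_filter, Finset.mem_powersetCard] at hA ⊢
    exact ⟨hA.1, hv A hA.1.1 hA.2⟩
  · rw [Finset.card_eq_zero.2 (Finset.filter_eq_empty_iff.2 fun A hA h =>
      hZ ((Finset.mem_powersetCard.1 hA).1 (hv A (Finset.mem_powersetCard.1 hA).1 h)))]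
    exact Nat.zero_le _

/-! ### Planting points of overlap, and uniformity of the result -/

variable [Fintype D]

/-- The number of points of `Z` that `φ` maps into `Z`. -/
def overlap (Z : Finset D) (φ : Equiv.Perm D) : ℕ := (Z.filter fun u => φ u ∈ Z).card

/-- The data `(χ, A, γ)` of a permutation `χ` that maps no point of `Z` into `Z`, a `K`-element
subset `A` of `Z`, and a bijection `γ` from `Z` onto the preimage of `Z` under `χ`, extended to
all points. -/
def swapData (Z : Finset D) (K : ℕ) : Finset (Equiv.Perm D × Finset D × Equiv.Perm D) :=
  Finset.univ.filter fun ω => (∀ u ∈ Z, ω.1 u ∉ Z ∧ ω.2.2 u ∉ Z ∧ ω.1 (ω.2.2 u) ∈ Z) ∧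
    ω.2.1 ∈ Z.powersetCard K

theorem mem_swapData {Z : Finset D} {K : ℕ} {χ γ : Equiv.Perm D} {A : Finset D} :
    (χ, A, γ) ∈ swapData Z K ↔
      (∀ u ∈ Z, χ u ∉ Z ∧ γ u ∉ Z ∧ χ (γ u) ∈ Z) ∧ A ⊆ Z ∧ A.card = K := by
  simp [swapData, Finset.mem_powersetCard]

/-- The permutation with overlap `K` obtained from the data. -/
noncomputable def swapped (ω : Equiv.Perm D × Finset D × Equiv.Perm D) : Equiv.Perm D :=
  ω.1 * swapPerm ω.2.1 ω.2.2

theorem notMem_of_mem_swapData {Z : Finset D} {K : ℕ} {χ γ : Equiv.Perm D} {A : Finset D}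
    (h : (χ, A, γ) ∈ swapData Z K) : ∀ u ∈ A, γ u ∉ A := by
  obtain ⟨h1, h2, -⟩ := mem_swapData.1 h
  exact fun u hu hγ => (h1 u (h2 hu)).2.1 (h2 hγ)

theorem swapped_apply {Z : Finset D} {K : ℕ} {χ γ : Equiv.Perm D} {A : Finset D}
    (h : (χ, A, γ) ∈ swapData Z K) (u : D) : swapped (χ, A, γ) u = χ (swapOn A γ u) := by
  rw [swapped, Equiv.Perm.mul_apply, swapPerm_apply (notMem_of_mem_swapData h)]

theorem swapped_symm_apply {Z : Finset D} {K : ℕ} {χ γ : Equiv.Perm D} {A : Finset D}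
    (h : (χ, A, γ) ∈ swapData Z K) (u : D) :
    (swapped (χ, A, γ)).symm u = swapOn A γ (χ.symm u) := by
  rw [← swapPerm_symm_apply (notMem_of_mem_swapData h)]; rfl

/-- A point of `A` goes to `χ (γ u) ∈ Z`; any other point of `Z` is not in `γ A`, hence is not
exchanged, and `χ` sends it off `Z`. -/
theorem swapped_mem_iff {Z : Finset D} {K : ℕ} {χ γ : Equiv.Perm D} {A : Finset D}
    (h : (χ, A, γ) ∈ swapData Z K) {u : D} (hu : u ∈ Z) : swapped (χ, A, γ) u ∈ Z ↔ u ∈ A := by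
  obtain ⟨h1, h2, -⟩ := mem_swapData.1 h
  rw [swapped_apply h, swapOn]
  split_ifs with hA hγ
  · simp [hA, h1 u hu]
  · have := (h1 _ (h2 hγ)).2.1
    simp [hu] at this
  · simp [hA, h1 u hu]

theorem overlap_swapped {Z : Finset D} {K : ℕ} {ω : Equiv.Perm D × Finset D × Equiv.Perm D}
    (h : ω ∈ swapData Z K) : overlap Z (swapped ω) = K := by
  obtain ⟨χ, A, γ⟩ := ω
  obtain ⟨-, h2, h3⟩ := mem_swapData.1 h
  rw [overlap, ← h3]
  congr 1
  ext u
  rw [Finset.mem_filter]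
  exact ⟨fun hu => (swapped_mem_iff h hu.1).1 hu.2,
    fun hu => ⟨h2 hu, (swapped_mem_iff h (h2 hu)).2 hu⟩⟩

/-- The four classes of points, sorted by membership of `u` and `φ u` in `Z`, have sizes determined
by the overlap. The additive form avoids truncated subtraction. -/
theorem card_fibre (Z : Finset D) (φ : Equiv.Perm D) :
    (Finset.univ.filter fun u => u ∈ Z ∧ φ u ∈ Z).card = overlap Z φ ∧
    (Finset.univ.filter fun u => u ∈ Z ∧ φ u ∉ Z).card + overlap Z φ = Z.card ∧
    (Finset.univ.filter fun u => u ∉ Z ∧ φ u ∈ Z).card + overlap Z φ = Z.card ∧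
    (Finset.univ.filter fun u => u ∉ Z ∧ φ u ∉ Z).card + 2 * Z.card =
      Fintype.card D + overlap Z φ := by
  have h0 : (Finset.univ.filter fun u => u ∈ Z ∧ φ u ∈ Z).card = overlap Z φ := by
    rw [overlap]; congr 1; ext u; simp
  have h1 : (Finset.univ.filter fun u => φ u ∈ Z).card = Z.card := by
    rw [← Finset.card_map φ.symm.toEmbedding (s := Z)]
    congr 1; ext u; simp [Finset.mem_map_equiv]
  have h2 : (Finset.univ.filter fun u => u ∈ Z).card = Z.card := by
    congr 1; ext u; simp
  have h3 := Finset.card_filter_add_card_filter_not (s := Finset.univ.filter fun u => u ∈ Z)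
    (fun u => φ u ∈ Z)
  have h4 := Finset.card_filter_add_card_filter_not (s := Finset.univ.filter fun u => u ∉ Z)
    (fun u => φ u ∈ Z)
  have h5 := Finset.card_filter_add_card_filter_not (s := Finset.univ.filter fun u => φ u ∈ Z)
    (fun u => u ∈ Z)
  have h6 := Finset.card_filter_add_card_filter_not (s := Finset.univ) (fun u => u ∈ Z)
  simp only [Finset.filter_filter, Finset.card_univ] at h3 h4 h5 h6
  simp only [and_comm (a := φ _ ∈ Z)] at h5
  omega

/-- The permutations of a given overlap form one double coset of the stabilizer of `Z`. -/
theorem exists_conj_of_overlap_eq (Z : Finset D) {φ₁ φ₂ : Equiv.Perm D}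
    (h : overlap Z φ₁ = overlap Z φ₂) :
    ∃ σ τ : Equiv.Perm D, (∀ u, σ u ∈ Z ↔ u ∈ Z) ∧ (∀ u, τ u ∈ Z ↔ u ∈ Z) ∧
      φ₂ = σ * φ₁ * τ⁻¹ := by
  obtain ⟨τ, hτ⟩ := exists_perm_comp_eq
    (fun u => (decide (u ∈ Z), decide (φ₁ u ∈ Z))) (fun u => (decide (u ∈ Z), decide (φ₂ u ∈ Z)))
    (by
      have h1 := card_fibre Z φ₁
      have h2 := card_fibre Z φ₂
      rintro ⟨_ | _, _ | _⟩ <;> simp only [Prod.mk.injEq, decide_eq_true_eq, decide_eq_false_iff_not]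
        <;> omega)
  simp only [Prod.mk.injEq, decide_eq_decide] at hτ
  -- `τ` matches the classes of `φ₁` and `φ₂`. The factorization forces `σ`, which preserves `Z`
  -- because the images are matched too.
  refine ⟨φ₂ * τ * φ₁⁻¹, τ, fun u => ?_, fun u => (hτ u).1, by group⟩
  simpa using (hτ (φ₁⁻¹ u)).2

/-- The pair `(σ, τ)` carrying `φ₁` to `φ₂` also acts injectively on the data and commutes with
`swapped`. Exchanging `φ₁` and `φ₂` gives equality. -/
theorem card_fibre_swapped_le (Z : Finset D) (K : ℕ) {φ₁ φ₂ : Equiv.Perm D}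
    (h : overlap Z φ₁ = overlap Z φ₂) :
    ((swapData Z K).filter fun ω => swapped ω = φ₁).card ≤
      ((swapData Z K).filter fun ω => swapped ω = φ₂).card := by
  obtain ⟨σ, τ, hσ, hτ, rfl⟩ := exists_conj_of_overlap_eq Z h
  refine Finset.card_le_card_of_injOn
    (fun ω => (σ * ω.1 * τ⁻¹, ω.2.1.map τ.toEmbedding, τ * ω.2.2 * τ⁻¹)) ?_ ?_
  · rintro ⟨χ, A, γ⟩ hω
    simp only [Finset.coe_filter, Set.mem_ofPred_eq] at hω ⊢
    obtain ⟨hω, rfl⟩ := hω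
    have hmem : (σ * χ * τ⁻¹, A.map τ.toEmbedding, τ * γ * τ⁻¹) ∈ swapData Z K := by
      obtain ⟨h1, h2, h3⟩ := mem_swapData.1 hω
      refine mem_swapData.2 ⟨fun u hu => ?_, fun u hu => ?_, by rw [Finset.card_map, h3]⟩
      · have := h1 (τ⁻¹ u) (by rwa [← hτ, Equiv.Perm.inv_def, Equiv.apply_symm_apply])
        simpa [hσ, hτ] using this
      · obtain ⟨v, hv, rfl⟩ := Finset.mem_map.1 hu
        exact (hτ v).2 (h2 hv)
    refine ⟨hmem, Equiv.ext fun u => ?_⟩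
    obtain ⟨v, rfl⟩ := τ.surjective u
    rw [swapped_apply hmem, swapOn_map]
    simp [swapped_apply hω]
  · rintro ⟨χ, A, γ⟩ - ⟨χ', A', γ'⟩ - h
    simpa using h

/-- `swapped` takes all values of overlap `K` equally often. -/
theorem sum_swapped (Z : Finset D) (K : ℕ) (hne : (swapData Z K).Nonempty)
    (P : Finset (Equiv.Perm D)) (hP : ∀ φ, φ ∈ P ↔ overlap Z φ = K) :
    ∃ k : ℕ, 0 < k ∧ ∀ g : Equiv.Perm D → ℝ,
      ∑ ω ∈ swapData Z K, g (swapped ω) = k * ∑ φ ∈ P, g φ := by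
  obtain ⟨ω₀, hω₀⟩ := hne
  have h0 := overlap_swapped hω₀
  refine ⟨((swapData Z K).filter fun ω => swapped ω = swapped ω₀).card,
    Finset.card_pos.2 ⟨ω₀, by simp [hω₀]⟩, fun g => ?_⟩
  rw [← Finset.sum_fiberwise_of_maps_to (t := P) (g := swapped)
    (fun ω hω => (hP _).2 (overlap_swapped hω)), Finset.mul_sum]
  refine Finset.sum_congr rfl fun φ hφ => ?_
  have hφ' : overlap Z φ = overlap Z (swapped ω₀) := ((hP φ).1 hφ).trans h0.symm
  rw [le_antisymm (card_fibre_swapped_le Z K hφ'.symm) (card_fibre_swapped_le Z K hφ'),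
    ← nsmul_eq_mul, ← Finset.sum_const]
  exact Finset.sum_congr rfl fun ω hω => by rw [(Finset.mem_filter.1 hω).2]

end swapOn

section swapBase

variable {D : Type*} [DecidableEq D] [Fintype D]

/-- The pairs `(χ, γ)` that occur in `swapData`. -/
def swapBase (Z : Finset D) : Finset (Equiv.Perm D × Equiv.Perm D) :=
  Finset.univ.filter fun p => ∀ u ∈ Z, p.1 u ∉ Z ∧ p.2 u ∉ Z ∧ p.1 (p.2 u) ∈ Z

theorem mem_swapData_iff_mem_swapBase {Z : Finset D} {K : ℕ} {χ γ : Equiv.Perm D}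
    {A : Finset D} :
    (χ, A, γ) ∈ swapData Z K ↔ (χ, γ) ∈ swapBase Z ∧ A ∈ Z.powersetCard K := by
  simp [swapData, swapBase]

theorem sum_swapData (Z : Finset D) (K : ℕ) (f : Equiv.Perm D × Finset D × Equiv.Perm D → ℝ) :
    ∑ ω ∈ swapData Z K, f ω =
      ∑ p ∈ swapBase Z, ∑ A ∈ Z.powersetCard K, f (p.1, A, p.2) := by
  rw [← Finset.sum_product']
  refine Finset.sum_nbij' (fun ω => ((ω.1, ω.2.2), ω.2.1)) (fun q => (q.1.1, q.2, q.1.2))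
    ?_ ?_ (fun _ _ => rfl) (fun _ _ => rfl) (fun _ _ => rfl)
  · rintro ⟨χ, A, γ⟩ h
    exact Finset.mem_product.2 (mem_swapData_iff_mem_swapBase.1 h)
  · rintro ⟨⟨χ, γ⟩, A⟩ h
    exact mem_swapData_iff_mem_swapBase.2 (Finset.mem_product.1 h)

end swapBase

/-! ### Zero pairs as overlap of the set of padded strings -/

theorem padZero_injective {n : ℕ} : Function.Injective (padZero (n := n)) := by
  intro x y h
  funext i
  simpa [padZero] using congrFun h (Fin.castAdd n i)

/-- The strings of the form `x ‖ 0ⁿ`. -/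
def padded (n : ℕ) : Finset (Bits (n + n)) := Finset.univ.map ⟨padZero, padZero_injective⟩

theorem mem_padded {n : ℕ} {u : Bits (n + n)} : u ∈ padded n ↔ ∃ x, padZero x = u := by
  simp [padded]

theorem padZero_mem_padded {n : ℕ} (x : Bits n) : padZero x ∈ padded n := mem_padded.2 ⟨x, rfl⟩

theorem card_padded (n : ℕ) : (padded n).card = 2 ^ n := by
  simp [padded]

theorem mem_zeroPairs {n : ℕ} {φ : BitPerm n} {p : Bits n × Bits n} :
    p ∈ zeroPairs φ ↔ φ (padZero p.1) = padZero p.2 := by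
  simp [zeroPairs]

theorem card_zeroPairs {n : ℕ} (φ : BitPerm n) : (zeroPairs φ).card = overlap (padded n) φ := by
  refine Finset.card_nbij (fun p => padZero p.1) ?_ ?_ ?_
  · intro p hp
    have := mem_zeroPairs.1 hp
    simp [padZero_mem_padded, this]
  · intro p hp q hq h
    have h1 := mem_zeroPairs.1 hp
    have h2 := mem_zeroPairs.1 hq
    have h3 : p.1 = q.1 := padZero_injective h
    exact Prod.ext h3 (padZero_injective (by rw [← h1, ← h2, h3]))
  · intro u hu
    obtain ⟨hu, hv⟩ := Finset.mem_filter.1 hu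
    obtain ⟨x, rfl⟩ := mem_padded.1 hu
    obtain ⟨y, hy⟩ := mem_padded.1 hv
    exact ⟨(x, y), mem_zeroPairs.2 hy.symm, rfl⟩

/-- Flipping the last `n` bits. -/
def flipLast (n : ℕ) : BitPerm n :=
  Function.Involutive.toPerm (fun u => bxor u (Fin.append (fun _ => false) (fun _ => true)))
    fun _ => bxor_bxor _ _

theorem flipLast_notMem {n : ℕ} (hn : n ≠ 0) {u : Bits (n + n)} (hu : u ∈ padded n) :
    flipLast n u ∉ padded n := by
  obtain ⟨x, rfl⟩ := mem_padded.1 hu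
  intro h
  obtain ⟨y, hy⟩ := mem_padded.1 h
  have key : ∀ i : Fin n, False := fun i => by
    have := congrFun hy (Fin.natAdd n i)
    rw [show flipLast n (padZero x) = bxor (padZero x) _ from rfl] at this
    simp only [padZero, bxor, Fin.append_right] at this
    simp at this
  exact key ⟨0, Nat.pos_of_ne_zero hn⟩

/-- An involution moving `Z` off itself serves as both `χ` and `γ`. For `n = 0` none exists, as `Z`
is then everything. -/
theorem flipLast_mem_swapBase {n : ℕ} (hn : n ≠ 0) :
    (flipLast n, flipLast n) ∈ swapBase (padded n) := by
  refine Finset.mem_filter.2 ⟨Finset.mem_univ _, fun u hu =>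
    ⟨flipLast_notMem hn hu, flipLast_notMem hn hu, ?_⟩⟩
  have : flipLast n (flipLast n u) = u := bxor_bxor _ _
  rwa [this]

/-! ### Assembling the average-case bound -/

/-- The search bound on average over the subset `A`, for fixed `χ` and `γ`. -/
theorem sum_successProb_swapped_le {n m k T : ℕ} {χ γ : BitPerm n}
    (h : (χ, γ) ∈ swapBase (padded n)) (A : QueryAlg n m) (hA : A.queryCount ≤ T) :
    ∑ B ∈ (padded n).powersetCard (k + 1), successProb A (swapped (χ, B, γ)) ≤
      8 * ((T : ℝ) + 1) ^ 2 * ((2 ^ n - 1).choose k : ℕ) := by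
  have hmem : ∀ B ∈ (padded n).powersetCard (k + 1), (χ, B, γ) ∈ swapData (padded n) (k + 1) :=
    fun B hB => mem_swapData_iff_mem_swapBase.2 ⟨h, hB⟩
  have hbase := (Finset.mem_filter.1 h).2
  have bound : ∀ (P : Finset (Bits (n + n)) → Prop) [DecidablePred P] (u : Bits (n + n)),
      (∀ B ∈ (padded n).powersetCard (k + 1), P B → swapOn B γ u ≠ u) →
      ((((padded n).powersetCard (k + 1)).filter P).card : ℝ) ≤ ((2 ^ n - 1).choose k : ℕ) := by
    intro P _ u hP
    rw [← card_padded n]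
    refine Nat.cast_le.2 (le_trans (Finset.card_le_card fun B hB => ?_)
      (card_filter_mem_or_mem_le (fun u hu => (hbase u hu).2.1) k u))
    rw [Finset.mem_filter] at hB ⊢
    exact ⟨hB.1, mem_or_mem_of_swapOn_ne (hP B hB.1 hB.2)⟩
  refine sum_successProb_le _ (Nat.cast_nonneg _) _ χ (fun u => ?_) (fun u => ?_) (fun p => ?_)
    A hA
  · refine bound _ u fun B hB hu hs => hu ?_
    rw [swapped_apply (hmem B hB), hs]
  · refine bound _ (χ.symm u) fun B hB hu hs => hu ?_
    rw [swapped_symm_apply (hmem B hB), hs]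
  -- `χ` has no zero pairs, so a zero pair of the planted permutation must start at an exchanged
  -- point.
  · refine bound _ (padZero p.1) fun B hB hu hs => ?_
    have h1 := mem_zeroPairs.1 hu
    rw [swapped_apply (hmem B hB), hs] at h1
    exact (hbase _ (padZero_mem_padded p.1)).1 (h1 ▸ padZero_mem_padded p.2)

theorem averageSuccessProb_le_one {n m : ℕ} (A : QueryAlg n m) (K : ℕ) :
    averageSuccessProb A K ≤ 1 := by
  refine div_le_one_of_le₀ ?_ (Nat.cast_nonneg _)
  calc _ ≤ ∑ φ ∈ permsWithZeroPairs n K, (1 : ℝ) :=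
        Finset.sum_le_sum fun φ _ => successProb_le_one A φ
    _ = _ := by simp

/-- Average-case hardness of double-sided zero-search. -/
theorem averageSuccessProb_le (n m K T : ℕ) (hK : 0 < K) (A : QueryAlg n m)
    (hA : A.queryCount ≤ T) :
    averageSuccessProb A K ≤ 8 * ((T : ℝ) + 1) ^ 2 * (K : ℝ) / 2 ^ n := by
  -- For `K > 2 ^ n` or `n = 0` the right side is at least 1, so the trivial bound suffices;
  -- otherwise planting data exist.
  have hK1 : (1 : ℝ) ≤ K := by exact_mod_cast hK
  rcases lt_or_ge (2 ^ n) K with hKn | hKn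
  · refine (averageSuccessProb_le_one A K).trans ?_
    rw [le_div_iff₀ (by positivity), one_mul]
    have h1 : (2 : ℝ) ^ n ≤ K := by exact_mod_cast hKn.le
    nlinarith [Nat.cast_nonneg (α := ℝ) T, sq_nonneg (T : ℝ)]
  rcases eq_or_ne n 0 with rfl | hn
  · refine (averageSuccessProb_le_one A K).trans ?_
    rw [le_div_iff₀ (by positivity), one_mul, pow_zero]
    nlinarith [Nat.cast_nonneg (α := ℝ) T, sq_nonneg (T : ℝ)]
  obtain ⟨k, rfl⟩ : ∃ k, K = k + 1 := ⟨K - 1, by omega⟩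
  have hne : (swapData (padded n) (k + 1)).Nonempty := by
    obtain ⟨B, hB⟩ := Finset.powersetCard_nonempty.2 (hKn.trans_eq (card_padded n).symm)
    exact ⟨(flipLast n, B, flipLast n),
      mem_swapData_iff_mem_swapBase.2 ⟨flipLast_mem_swapBase hn, hB⟩⟩
  obtain ⟨c, hc, hsum⟩ := sum_swapped (padded n) (k + 1) hne (permsWithZeroPairs n (k + 1))
    fun φ => by simp [permsWithZeroPairs, card_zeroPairs]
  -- The constant function counts the data, which supplies the normalization for the average.
  have hcard := hsum fun _ => 1
  have hsucc := hsum (successProb A)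
  rw [sum_swapData] at hcard hsucc
  simp only [Finset.sum_const, Finset.card_powersetCard, card_padded, nsmul_eq_mul, mul_one]
    at hcard
  set P : ℝ := ((permsWithZeroPairs n (k + 1)).card : ℝ) with hP
  have hle : ∑ p ∈ swapBase (padded n), ∑ B ∈ (padded n).powersetCard (k + 1),
      successProb A (swapped (p.1, B, p.2)) ≤
      (swapBase (padded n)).card * (8 * ((T : ℝ) + 1) ^ 2 * ((2 ^ n - 1).choose k : ℕ)) := by
    rw [← nsmul_eq_mul, ← Finset.sum_const]
    exact Finset.sum_le_sum fun p hp => sum_successProb_swapped_le hp A hA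
  -- The absorption identity, which turns `(N - 1).choose k / N.choose (k + 1)` into `(k + 1) / N`.
  have hchoose : (2 : ℝ) ^ n * ((2 ^ n - 1).choose k : ℕ) =
      ((2 ^ n).choose (k + 1) : ℕ) * ((k + 1 : ℕ) : ℝ) := by
    have := Nat.add_one_mul_choose_eq (2 ^ n - 1) k
    rw [Nat.sub_add_cancel Nat.one_le_two_pow] at this
    exact_mod_cast this
  have hc' : (0 : ℝ) < c := by exact_mod_cast hc
  rw [averageSuccessProb]
  refine div_le_of_le_mul₀ (Nat.cast_nonneg _) (by positivity) ?_
  refine le_of_mul_le_mul_left ?_ hc'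
  rw [← hsucc]
  refine hle.trans (le_of_eq ?_)
  rw [← hP, div_mul_eq_mul_div, mul_div_assoc', eq_div_iff (by positivity)]
  calc _ = (swapBase (padded n)).card * (8 * ((T : ℝ) + 1) ^ 2 *
        ((2 : ℝ) ^ n * ((2 ^ n - 1).choose k : ℕ))) := by ring
    _ = 8 * ((T : ℝ) + 1) ^ 2 * ((k + 1 : ℕ) : ℝ) *
        ((swapBase (padded n)).card * ((2 ^ n).choose (k + 1) : ℕ)) := by rw [hchoose]; ring
    _ = _ := by rw [hcard]; ring

end ZeroSearch

theorem mainTheorem6 (n m K T : ℕ) (hK : 0 < K) (A : ZeroSearch.QueryAlg n m)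
    (hA : A.queryCount ≤ T) :
    ZeroSearch.averageSuccessProb A K ≤ 8 * ((T : ℝ) + 1) ^ 2 * (K : ℝ) / 2 ^ n :=
  ZeroSearch.averageSuccessProb_le n m K T hK A hA
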